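/- Let $n\ge 4$. Let $\mathbf C_n=(\{0,1,\dots,n-1\};\wedge,\vee,\to,\bot,\top)$ be the $n$-element Heyting chain $0<1<\dots<n-1$, and let $\mathcal G_n=\mathbb{ISP}(\mathbf C_n)$ be the class of Heyting algebras isomorphic to a subalgebra of a power of $\mathbf C_n$. For $1\le i\le n-3$ let $g_i$ be the partial endomorphism of $\mathbf C_n$ with domain $\{0,\dots,n-1\}\setminus\{i\}$ given by $g_i(i+1)=i$ and $g_i(x)=x$ for $x\ne i+1$; let $h_1$ be the endomorphism with $h_1(x)=x+1$ if $1\le x<n-1$ and $h_1(x)=x$ otherwise; and let $\sigma=(g_1,\dots,g_{n-3},h_1)$. For $\mathbf A\in\mathcal G_n$ let $D^\sigma(\mathbf A)$ be the set of homomorphisms $\mathbf A\to\mathbf C_n$, with the topology induced from the product $\{0,\dots,n-1\}^A$ of discrete spaces, and with the operations of $\sigma$ lifted pointwise: $g_i$ is defined at $x$ if and only if $i\notin x(A)$, with value $g_i\circ x$, and $h_1$ sends $x$ to $h_1\circ x$. For a homomorphism $f\colon\mathbf A\to\mathbf B$ let $D^\sigma(f)\colon D^\sigma(\mathbf B)\to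 D^\sigma(\mathbf A)$, $x\mapsto x\circ f$. On $X=D^\sigma(\mathbf A)$ write $x\simeq_X y$ if $x=y$ or there is a finite sequence $z_0=x,\dots,z_N=y$ in $X$ such that for each $j<N$ there is $i\in\{1,\dots,n-3\}$ with $z_{j+1}=g_i\circ z_j$ or $z_j=g_i\circ z_{j+1}$ (with the right-hand side defined). Let $\mathbf A,\mathbf B,\mathbf C\in\mathcal G_n$ and let $f_B\colon\mathbf A\to\mathbf B$ and $f_C\colon\mathbf A\to\mathbf C$ be injective homomorphisms (a V-formation in $\mathcal G_n$). Then the following are equivalent. (1) The V-formation admits amalgamation in $\mathcal G_n$: there are $\mathbf D\in\mathcal G_n$ and injective homomorphisms $h_B\colon\mathbf B\to\mathbf D$, $h_C\colon\mathbf C\to\mathbf D$ with $h_B\circ f_B=h_C\circ f_C$. (2) Both of the following hold: (a) for each $x\in D^\sigma(\mathbf B)$ there exist $y\in D^\sigma(\mathbf B)$ and $z\in D^\sigma(\mathbf C)$ such that $x\simeq_{D^\sigma(\mathbf B)}y$ and $D^\sigma(f_B)(y)=D^\sigma(f_C)(z)$; (b) for each $x'\in D^\sigma(\mathbf C)$ there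 exist $y'\in D^\sigma(\mathbf C)$ and $z'\in D^\sigma(\mathbf B)$ such that $x'\simeq_{D^\sigma(\mathbf C)}y'$ and $D^\sigma(f_C)(y')=D^\sigma(f_B)(z')$. -/

import Mathlib

universe u

namespace Goedel

/-! Finite Heyting chains, with universe `Fin n`, i.e. `0 < 1 < ⋯ < n - 1`. -/

/-- The implication of the `n`-element Heyting chain. -/
theorem chain_himp {n : ℕ} [NeZero n] (a b : Fin n) :
    a ⇨ b = if a ≤ b then ⊤ else b := rfl

theorem chain_bot_val {n : ℕ} [NeZero n] : ((⊥ : Fin n) : ℕ) = 0 := rfl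

theorem chain_top_val {n : ℕ} [NeZero n] : ((⊤ : Fin n) : ℕ) = n - 1 := by
  have h : (⟨n - 1, Nat.sub_lt (NeZero.pos n) one_pos⟩ : Fin n) ≤ ⊤ := le_top
  have h' : n - 1 ≤ ((⊤ : Fin n) : ℕ) := h
  have := (⊤ : Fin n).isLt
  omega

/-- The class `ISP(C_n)`: the Heyting algebras isomorphic to a subalgebra of a power of the
`n`-element Heyting chain (i.e. admitting an embedding into such a power). -/
def InG (n : ℕ) [NeZero n] (A : Type u) [HeytingAlgebra A] : Prop :=
  ∃ (I : Type u) (e : HeytingHom A (I → Fin n)), Function.Injective e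

/-- The V-formation `B ← A → C` admits amalgamation in the class `ISP(C_n)`. -/
def AdmitsAmalgamation (n : ℕ) [NeZero n] {A B C : Type u} [HeytingAlgebra A]
    [HeytingAlgebra B] [HeytingAlgebra C] (fB : HeytingHom A B) (fC : HeytingHom A C) : Prop :=
  ∃ (D : Type u) (_ : HeytingAlgebra D), InG n D ∧
    ∃ (hB : HeytingHom B D) (hC : HeytingHom C D),
      Function.Injective hB ∧ Function.Injective hC ∧ hB.comp fB = hC.comp fC

/-! Partial endomorphisms and alter egos. -/

/-- A partial endomorphism of a Heyting algebra `L`: a homomorphism into `L` from a subalgebra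
of `L`; equivalently a partial function whose graph is a subalgebra of `L × L`. -/
structure PartialEndo (L : Type) [HeytingAlgebra L] where
  toPFun : L →. L
  bot_mem : ⊥ ∈ toPFun ⊥
  top_mem : ⊤ ∈ toPFun ⊤
  inf_mem : ∀ {a b a' b' : L}, a' ∈ toPFun a → b' ∈ toPFun b → a' ⊓ b' ∈ toPFun (a ⊓ b)
  sup_mem : ∀ {a b a' b' : L}, a' ∈ toPFun a → b' ∈ toPFun b → a' ⊔ b' ∈ toPFun (a ⊔ b)
  himp_mem : ∀ {a b a' b' : L}, a' ∈ toPFun a → b' ∈ toPFun b → a' ⇨ b' ∈ toPFun (a ⇨ b)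

/-- The pointwise lifting of a partial endomorphism `g` of `L` to the set of homomorphisms
`A → L`: it is defined at `x` iff the range of `x` is contained in the domain of `g`,
and then its value at `x` is `g ∘ x`. -/
def PartialEndo.lift {L : Type} [HeytingAlgebra L] (g : PartialEndo L) (A : Type u)
    [HeytingAlgebra A] : HeytingHom A L →. HeytingHom A L := fun x =>
  ⟨∀ a, (g.toPFun (x a)).Dom, fun hx =>
    { toFun := fun a => (g.toPFun (x a)).get (hx a)
      map_sup' := fun a b => Part.get_eq_of_mem
        (by rw [map_sup]; exact g.sup_mem (Part.get_mem _) (Part.get_mem _)) _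
      map_inf' := fun a b => Part.get_eq_of_mem
        (by rw [map_inf]; exact g.inf_mem (Part.get_mem _) (Part.get_mem _)) _
      map_bot' := Part.get_eq_of_mem (by rw [map_bot]; exact g.bot_mem) _
      map_himp' := fun a b => Part.get_eq_of_mem
        (by rw [map_himp]; exact g.himp_mem (Part.get_mem _) (Part.get_mem _)) _ }⟩

/-- An alter ego of a finite Heyting algebra `L` (with the discrete topology), whose structure
consists of a family of partial endomorphisms indexed by `ι` and one endomorphism. -/
structure AlterEgo (L : Type) [HeytingAlgebra L] (ι : Type) where
  part : ι → PartialEndo L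
  total : HeytingHom L L

/-- Topological structures with `ι`-indexed unary partial operations and one unary
operation. -/
structure OpSpace (ι : Type) where
  carrier : Type u
  topology : TopologicalSpace carrier
  part : ι → carrier →. carrier
  total : carrier → carrier

instance (ι : Type) : CoeSort (OpSpace.{u} ι) (Type u) := ⟨OpSpace.carrier⟩

instance (ι : Type) (X : OpSpace.{u} ι) : TopologicalSpace X := X.topology

/-- Morphisms: continuous structure-preserving maps. -/
structure OpSpace.Hom {ι : Type} (X Y : OpSpace.{u} ι) where
  toFun : X → Y
  continuous_toFun : Continuous toFun
  map_part : ∀ (i : ι) (x x' : X), x' ∈ X.part i x → toFun x' ∈ Y.part i (toFun x)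
  map_total : ∀ x : X, toFun (X.total x) = Y.total (toFun x)

instance {ι : Type} (X Y : OpSpace.{u} ι) : CoeFun (X.Hom Y) (fun _ => X → Y) :=
  ⟨OpSpace.Hom.toFun⟩

/-- The relation `≃` on a structure `X`: `x ≃ y` iff `x` and `y` are joined by a finite
(possibly empty) sequence, each member of which is obtained from the preceding one, or
the preceding one from it, by applying one of the partial operations of `X`. -/
def OpSpace.Equivalent {ι : Type} (X : OpSpace.{u} ι) : X → X → Prop :=
  Relation.ReflTransGen fun z z' => ∃ i : ι, z' ∈ X.part i z ∨ z ∈ X.part i z'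

/-- The dual space of `A`: the set of homomorphisms `A → L`, as a topological substructure
of the power of the alter ego by the set `A`. -/
def AlterEgo.dual {L : Type} [HeytingAlgebra L] {ι : Type} (σ : AlterEgo L ι)
    (A : Type u) [HeytingAlgebra A] : OpSpace.{u} ι where
  carrier := HeytingHom A L
  topology := TopologicalSpace.induced (fun x a => x a)
    (@Pi.topologicalSpace A (fun _ => L) (fun _ => ⊥))
  part := fun i => (σ.part i).lift A
  total := fun x => σ.total.comp x

/-- The dual map of a homomorphism `f : A → B`, namely `x ↦ x ∘ f`. -/
def AlterEgo.dualMap {L : Type} [HeytingAlgebra L] {ι : Type} (σ : AlterEgo L ι)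
    {A B : Type u} [HeytingAlgebra A] [HeytingAlgebra B] (f : HeytingHom A B) :
    (σ.dual B).Hom (σ.dual A) where
  toFun := fun x : HeytingHom B L => HeytingHom.comp x f
  continuous_toFun := by
    let _ : TopologicalSpace L := ⊥
    refine continuous_induced_rng.2 (continuous_pi fun a => ?_)
    exact (continuous_apply (f a)).comp
      (continuous_induced_dom (f := fun (x : HeytingHom B L) (b : B) => x b))
  map_part := by
    rintro i x x' ⟨hx, rfl⟩
    exact ⟨fun a => hx (f a), rfl⟩
  map_total := fun _ => rfl

/-! The particular endomorphisms and partial endomorphisms of the chain. -/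

/-- The map `h_i` on the chain: `h_i x = x + 1` if `i ≤ x < n - 1` and `h_i x = x` otherwise. -/
def hFun (n i : ℕ) (x : Fin n) : Fin n :=
  ⟨if i ≤ x.val ∧ x.val < n - 1 then x.val + 1 else x.val, by
    have := x.isLt
    split_ifs <;> omega⟩

theorem hFun_mono (n i : ℕ) : Monotone (hFun n i) := by
  intro a b h
  rw [Fin.le_def] at *
  simp only [hFun]
  split_ifs <;> omega

/-- For `1 ≤ i`, the map `h_i` as an endomorphism of the chain. -/
def hEndo (n : ℕ) [NeZero n] (i : ℕ) (hi : 1 ≤ i) : HeytingHom (Fin n) (Fin n) where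
  toFun := hFun n i
  map_sup' := (hFun_mono n i).map_sup
  map_inf' := (hFun_mono n i).map_inf
  map_bot' := by
    have ht := chain_bot_val (n := n)
    rw [Fin.ext_iff]
    simp only [hFun]
    split_ifs <;> omega
  map_himp' := fun a b => by
    have ht := chain_top_val (n := n)
    have ha := a.isLt
    have hb := b.isLt
    have htop : hFun n i ⊤ = ⊤ := by
      rw [Fin.ext_iff]
      simp only [hFun, ht]
      split_ifs <;> omega
    rw [chain_himp, chain_himp]
    by_cases h : a ≤ b
    · rw [if_pos h, if_pos (hFun_mono n i h), htop]
    · rw [if_neg h]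
      by_cases h' : hFun n i a ≤ hFun n i b
      · rw [if_pos h', Fin.ext_iff, ht]
        rw [Fin.le_def] at h h'
        simp only [hFun] at *
        split_ifs at * <;> omega
      · rw [if_neg h']

/-- The map fixing every element of the chain except `i + 1`, which is sent to `i`. -/
def gFun (n i : ℕ) (x : Fin n) : Fin n :=
  ⟨if x.val = i + 1 then i else x.val, by
    have := x.isLt
    split_ifs <;> omega⟩

theorem gFun_mono (n i : ℕ) : Monotone (gFun n i) := by
  intro a b h
  rw [Fin.le_def] at *
  simp only [gFun]
  split_ifs <;> omega

/-- For `1 ≤ i ≤ n - 3`, the partial endomorphism `g_i` of the chain, with domain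
`{x | x ≠ i}`, sending `i + 1` to `i` and fixing every other element of the domain. -/
def gEndo (n : ℕ) [NeZero n] (i : ℕ) (hi : i ∈ Set.Icc 1 (n - 3)) : PartialEndo (Fin n) where
  toPFun := fun x => ⟨x.val ≠ i, fun _ => gFun n i x⟩
  bot_mem := by
    obtain ⟨h1, h2⟩ := hi
    have ht := chain_bot_val (n := n)
    refine ⟨fun h => by omega, ?_⟩
    rw [Fin.ext_iff]
    simp only [gFun, ht]
    rw [if_neg (by omega)]
  top_mem := by
    obtain ⟨h1, h2⟩ := hi
    have ht := chain_top_val (n := n)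
    refine ⟨fun h => by omega, ?_⟩
    rw [Fin.ext_iff]
    simp only [gFun, ht]
    rw [if_neg (by omega)]
  inf_mem := by
    rintro a b _ _ ⟨ha, rfl⟩ ⟨hb, rfl⟩
    refine ⟨?_, (gFun_mono n i).map_inf a b⟩
    rcases min_choice a b with h | h
    · exact fun h' => ha (h ▸ h')
    · exact fun h' => hb (h ▸ h')
  sup_mem := by
    rintro a b _ _ ⟨ha, rfl⟩ ⟨hb, rfl⟩
    refine ⟨?_, (gFun_mono n i).map_sup a b⟩
    rcases max_choice a b with h | h
    · exact fun h' => ha (h ▸ h')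
    · exact fun h' => hb (h ▸ h')
  himp_mem := by
    rintro a b _ _ ⟨ha, rfl⟩ ⟨hb, rfl⟩
    obtain ⟨h1, h2⟩ := hi
    have ht := chain_top_val (n := n)
    change a.val ≠ i at ha
    change b.val ≠ i at hb
    change gFun n i a ⇨ gFun n i b ∈ (⟨(a ⇨ b).val ≠ i, fun _ => gFun n i (a ⇨ b)⟩ : Part (Fin n))
    rw [chain_himp a b, chain_himp]
    by_cases h : a ≤ b
    · rw [if_pos h, if_pos (gFun_mono n i h)]
      refine ⟨fun h => by omega, ?_⟩
      rw [Fin.ext_iff]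
      simp only [gFun, ht]
      rw [if_neg (by omega)]
    · rw [if_neg h, if_neg]
      · exact ⟨hb, rfl⟩
      · rw [Fin.le_def] at *
        simp only [gFun]
        split_ifs <;> omega

/-- The alter ego of the `n`-element chain given by `σ = (g_1, …, g_{n-3}, h_1)`. -/
def sigma (n : ℕ) [NeZero n] : AlterEgo (Fin n) (Set.Icc 1 (n - 3)) where
  part := fun i => gEndo n i.1 i.2
  total := hEndo n 1 le_rfl

end Goedel

namespace Goedel

/-! ### Homomorphisms into a chain and their kernel filters -/

section Kernel

variable {n : ℕ} [NeZero n] {B D : Type*} [HeytingAlgebra B] [HeytingAlgebra D]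

/-! The relation `≃` on a dual space is equality of kernel filters, i.e. preimages of `⊤`. Each
`g_i` preserves and reflects `⊤`, which gives one direction (`Equivalent.top_iff`). Conversely, the
kernel filter fixes the preorder that `x` induces, and applying the `g_i` pushes `x` down to a
packed form determined by that preorder (`equivalent_of_top_iff`).

So condition (a) says that every kernel filter on `B` comes from the first member of a pair `(y, z)`
agreeing on `A`; (b) is the same for `C`. In an amalgam, each kernel filter on `B` or `C` is the
trace of one on `D` (`InG.exists_extension`, by compactness), and restriction yields the pair.
Conversely, the power of the chain indexed by all such pairs is an amalgam, as kernel filters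
separate points (`homPi_injective`). -/

theorem map_himp_eq_top_iff_le (x : HeytingHom B (Fin n)) (a b : B) :
    x (a ⇨ b) = ⊤ ↔ x a ≤ x b := by
  rw [map_himp, himp_eq_top_iff]

/-- Homomorphisms into a chain with the same kernel filter induce the same preorder. -/
theorem le_iff_le_of_top_iff {x y : HeytingHom B (Fin n)} (h : ∀ b, x b = ⊤ ↔ y b = ⊤) (a b : B) :
    x a ≤ x b ↔ y a ≤ y b := by
  rw [← map_himp_eq_top_iff_le, ← map_himp_eq_top_iff_le, h]

theorem lt_iff_lt_of_top_iff {x y : HeytingHom B (Fin n)} (h : ∀ b, x b = ⊤ ↔ y b = ⊤) (a b : B) :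
    x a < x b ↔ y a < y b := by
  simpa only [not_le] using not_congr (le_iff_le_of_top_iff h b a)

/-- The endomorphism of the chain which collapses the filter generated by `a ≠ ⊥` to `⊤`. -/
def collapse (a : Fin n) (ha : a ≠ ⊥) : HeytingHom (Fin n) (Fin n) :=
  have hm : Monotone fun x : Fin n => if a ≤ x then ⊤ else x := by
    intro x y h
    dsimp only
    split_ifs with h1 h2
    · exact le_rfl
    · exact absurd (h1.trans h) h2
    · exact le_top
    · exact h
  { toFun := fun x => if a ≤ x then ⊤ else x
    map_sup' := hm.map_sup
    map_inf' := hm.map_inf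
    map_bot' := if_neg fun h => ha (le_bot_iff.1 h)
    map_himp' := fun x y => by
      rw [chain_himp, chain_himp]
      by_cases hxy : x ≤ y
      · rw [if_pos hxy, if_pos le_top]
        exact (if_pos (hm hxy)).symm
      · rw [if_neg hxy]
        by_cases hy : a ≤ y
        · rw [if_pos hy, if_pos le_top]
        · rw [if_neg hy, if_neg]
          split_ifs with hx
          · exact fun h => hy (le_top.trans h)
          · exact hxy }

theorem collapse_eq_top_iff {a : Fin n} (ha : a ≠ ⊥) (x : Fin n) :
    collapse a ha x = ⊤ ↔ a ≤ x := by
  change (if a ≤ x then ⊤ else x) = ⊤ ↔ a ≤ x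
  split_ifs with h
  · exact ⟨fun _ => h, fun _ => rfl⟩
  · exact ⟨fun hx => hx ▸ le_top, fun hx => absurd hx h⟩

/-- The limit of homomorphisms into a finite chain along an ultrafilter. -/
theorem exists_ultralimit (U : Ultrafilter (HeytingHom D (Fin n))) :
    ∃ v : HeytingHom D (Fin n), ∀ d, ∀ᶠ w in (U : Filter (HeytingHom D (Fin n))), w d = v d := by
  have key (d : D) : ∃ v : Fin n, ∀ᶠ w in (U : Filter (HeytingHom D (Fin n))), w d = v := by
    obtain ⟨v, hv⟩ := Ultrafilter.eq_pure_of_finite (U.map fun w => w d)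
    refine ⟨v, ?_⟩
    have : ({v} : Set (Fin n)) ∈ U.map fun w => w d := by
      rw [hv]
      exact Ultrafilter.mem_pure.2 rfl
    exact this
  choose v hv using key
  refine ⟨{ toFun := v, map_sup' := fun a b => ?_, map_inf' := fun a b => ?_, map_bot' := ?_,
            map_himp' := fun a b => ?_ }, hv⟩
  · obtain ⟨w, h, ha, hb⟩ := ((hv (a ⊔ b)).and ((hv a).and (hv b))).exists
    rw [← h, ← ha, ← hb, map_sup]
  · obtain ⟨w, h, ha, hb⟩ := ((hv (a ⊓ b)).and ((hv a).and (hv b))).exists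
    rw [← h, ← ha, ← hb, map_inf]
  · obtain ⟨w, h⟩ := (hv ⊥).exists
    rw [← h, map_bot]
  · obtain ⟨w, h, ha, hb⟩ := ((hv (a ⇨ b)).and ((hv a).and (hv b))).exists
    rw [← h, ← ha, ← hb, map_himp]

end Kernel

/-- In an algebra of `ISP(C_n)`, elements `a ≰ b` are separated by a homomorphism into the chain
sending `a`, but not `b`, to the top. -/
theorem InG.exists_top_ne_top {n : ℕ} [NeZero n] {D : Type u} [HeytingAlgebra D] (hD : InG n D)
    {a b : D} (hab : ¬a ≤ b) : ∃ w : HeytingHom D (Fin n), w a = ⊤ ∧ w b ≠ ⊤ := by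
  obtain ⟨I, e, he⟩ := hD
  have : ∃ i, e b i < e a i := by
    by_contra! hcon
    apply hab
    rw [← himp_eq_top_iff]
    apply he
    rw [map_himp, map_top, himp_eq_top_iff]
    exact hcon
  obtain ⟨i, hi⟩ := this
  have ha : e a i ≠ ⊥ := (bot_le.trans_lt hi).ne'
  let p : HeytingHom (I → Fin n) (Fin n) :=
    { toFun := fun f => f i
      map_sup' := fun _ _ => rfl
      map_inf' := fun _ _ => rfl
      map_bot' := rfl
      map_himp' := fun _ _ => rfl }
  -- Collapsing above `e a i` sends `a` to `⊤` and leaves the smaller `e b i` below it.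
  exact ⟨(collapse _ ha).comp (p.comp e), (collapse_eq_top_iff ha _).2 le_rfl,
    fun h => hi.not_ge ((collapse_eq_top_iff ha _).1 h)⟩

/-- Every kernel filter on a subalgebra `B` of `D` is the trace of a kernel filter on `D`. -/
theorem InG.exists_extension {n : ℕ} [NeZero n] (hn : 2 ≤ n) {B D : Type u} [HeytingAlgebra B]
    [HeytingAlgebra D] (hD : InG n D) (h : HeytingHom B D) (hh : Function.Injective h)
    (x : HeytingHom B (Fin n)) :
    ∃ w : HeytingHom D (Fin n), ∀ b, x b = ⊤ ↔ w (h b) = ⊤ := by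
  let S : Type u := { p : B × B // x p.1 = ⊤ ∧ x p.2 ≠ ⊤ }
  let T (p : S) : Set (HeytingHom D (Fin n)) := {w | w (h p.1.1) = ⊤ ∧ w (h p.1.2) ≠ ⊤}
  have hbt : (⊥ : Fin n) ≠ ⊤ := by
    intro h
    have := congrArg Fin.val h
    rw [chain_bot_val, chain_top_val] at this
    omega
  have hS : Nonempty S := ⟨⟨(⊤, ⊥), map_top x, by rw [map_bot]; exact hbt⟩⟩
  -- Directedness is primality: in a chain the join of two non-top elements is not top.
  have hdir : Directed (· ≥ ·) fun p : S => Filter.principal (T p) := by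
    rintro ⟨⟨b, c⟩, hb, hc⟩ ⟨⟨b', c'⟩, hb', hc'⟩
    dsimp only at hb hc hb' hc'
    refine ⟨⟨(b ⊓ b', c ⊔ c'), ?_, ?_⟩, ?_, ?_⟩
    · rw [map_inf, hb, hb', inf_top_eq]
    · rw [map_sup]
      rcases max_choice (x c) (x c') with h | h
      · exact fun h' => hc (h ▸ h')
      · exact fun h' => hc' (h ▸ h')
    all_goals
      refine Filter.principal_mono.2 ?_
      rintro w ⟨h1, h2⟩
      dsimp only at h1 h2
      rw [map_inf, map_inf, inf_eq_top_iff] at h1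
      rw [map_sup, map_sup] at h2
    · exact ⟨h1.1, fun h => h2 (by rw [h, top_sup_eq])⟩
    · exact ⟨h1.2, fun h => h2 (by rw [h, sup_top_eq])⟩
  have hne : (⨅ p : S, Filter.principal (T p)).NeBot := by
    refine Filter.iInf_neBot_of_directed' hdir ?_
    rintro ⟨⟨b, c⟩, hb, hc⟩
    dsimp only at hb hc
    rw [Filter.principal_neBot_iff]
    refine hD.exists_top_ne_top (a := h b) (b := h c) fun hle => hc ?_
    have hbc : b ⇨ c = ⊤ := hh (by rw [map_himp, map_top, himp_eq_top_iff.2 hle])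
    rw [← top_le_iff, ← hb, ← map_himp_eq_top_iff_le, hbc, map_top]
  obtain ⟨w, hw⟩ := exists_ultralimit (Ultrafilter.of (⨅ p : S, Filter.principal (T p)))
  have hT (p : S) : ∀ᶠ v in (Ultrafilter.of (⨅ p : S, Filter.principal (T p)) :
      Filter (HeytingHom D (Fin n))), v (h p.1.1) = ⊤ ∧ v (h p.1.2) ≠ ⊤ :=
    Ultrafilter.of_le _ (Filter.mem_iInf_of_mem p (Filter.mem_principal_self _))
  -- The pairs `(b, ⊥)` and `(⊤, b)` test the two implications.
  refine ⟨w, fun b => ⟨fun hb => ?_, fun hb => ?_⟩⟩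
  · obtain ⟨v, hv, hv'⟩ := ((hT ⟨(b, ⊥), hb, by rw [map_bot]; exact hbt⟩).and (hw (h b))).exists
    exact hv' ▸ hv.1
  · by_contra hxb
    obtain ⟨v, hv, hv'⟩ := ((hT ⟨(⊤, b), map_top x, hxb⟩).and (hw (h b))).exists
    exact hv.2 (hv'.trans hb)

/-! ### The relation `≃` on the dual space is equality of kernel filters -/

section Equivalent

variable {n : ℕ} [NeZero n] {B : Type u} [HeytingAlgebra B]

theorem mem_part_iff (i : Set.Icc 1 (n - 3)) (z z' : HeytingHom B (Fin n)) :
    z' ∈ ((sigma n).dual B).part i z ↔ ∀ b, (z b).val ≠ i ∧ z' b = gFun n i (z b) := by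
  constructor
  · rintro ⟨hx, rfl⟩ b
    exact ⟨hx b, rfl⟩
  · intro h
    exact ⟨fun b => (h b).1, DFunLike.ext (F := HeytingHom B (Fin n)) _ _ fun b => (h b).2.symm⟩

/-- The bound `i ≤ n - 3` keeps the moved point `i + 1` below the top. -/
theorem gFun_eq_top_iff {i : ℕ} (hi : i ∈ Set.Icc 1 (n - 3)) (x : Fin n) :
    gFun n i x = ⊤ ↔ x = ⊤ := by
  obtain ⟨h1, h2⟩ := hi
  have := x.isLt
  simp only [Fin.ext_iff, chain_top_val, gFun]
  split_ifs <;> omega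

theorem top_iff_of_mem_part {i : Set.Icc 1 (n - 3)} {z z' : HeytingHom B (Fin n)}
    (h : z' ∈ ((sigma n).dual B).part i z) (b : B) : z b = ⊤ ↔ z' b = ⊤ := by
  rw [((mem_part_iff i z z').1 h b).2, gFun_eq_top_iff i.2]

theorem Equivalent.top_iff {x y : HeytingHom B (Fin n)}
    (h : ((sigma n).dual B).Equivalent x y) (b : B) : x b = ⊤ ↔ y b = ⊤ := by
  induction h with
  | refl => rfl
  | tail _ h ih =>
    obtain ⟨i, h | h⟩ := h
    · exact ih.trans (top_iff_of_mem_part h b)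
    · exact ih.trans (top_iff_of_mem_part h b).symm

theorem Equivalent.symm {x y : (sigma n).dual B} (h : ((sigma n).dual B).Equivalent x y) :
    ((sigma n).dual B).Equivalent y x := by
  induction h with
  | refl => exact Relation.ReflTransGen.refl
  | tail _ h ih =>
    obtain ⟨i, h⟩ := h
    exact Relation.ReflTransGen.head ⟨i, h.symm⟩ ih

/-- The values of `x` strictly between bottom and top form an initial segment. -/
def IsPacked (x : HeytingHom B (Fin n)) : Prop :=
  ∀ i ∈ Set.Icc 1 (n - 3), (∃ b, (x b).val = i + 1) → ∃ b, (x b).val = i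

/-- If packedness fails at `i`, then `x` misses `i` but attains `i + 1`, so `g_i` applies and
strictly lowers the sum of the attained values. -/
theorem exists_isPacked_equivalent (x : HeytingHom B (Fin n)) :
    ∃ y : HeytingHom B (Fin n), IsPacked y ∧ ((sigma n).dual B).Equivalent x y := by
  classical
  let s (z : HeytingHom B (Fin n)) : Finset (Fin n) := Finset.univ.filter fun v => ∃ b, z b = v
  induction hm : (s x).sum (fun v => v.val) using Nat.strong_induction_on generalizing x with
  | _ m ih =>
    by_cases hx : IsPacked x
    · exact ⟨x, hx, Relation.ReflTransGen.refl⟩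
    simp only [IsPacked, not_forall] at hx
    obtain ⟨i, hi, ⟨b₀, hb₀⟩, hni⟩ := hx
    push Not at hni
    let y : HeytingHom B (Fin n) := ((gEndo n i hi).lift B x).get hni
    have hy : y ∈ ((sigma n).dual B).part ⟨i, hi⟩ x := ⟨hni, rfl⟩
    have hyv (b : B) : y b = gFun n i (x b) := rfl
    have hs : s y = (s x).image (gFun n i) := by
      ext v
      simp only [s, Finset.mem_filter, Finset.mem_univ, true_and, Finset.mem_image, hyv]
      exact ⟨fun ⟨b, hb⟩ => ⟨x b, ⟨b, rfl⟩, hb⟩, fun ⟨_, ⟨b, hb⟩, hv⟩ => ⟨b, hb ▸ hv⟩⟩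
    -- Only `i` and `i + 1` are identified, and `i` is not attained.
    have hinj : Set.InjOn (gFun n i) (s x) := by
      intro v hv w hw hvw
      simp only [s, Finset.coe_filter, Finset.mem_univ, true_and, Set.mem_ofPred_eq] at hv hw
      obtain ⟨b, rfl⟩ := hv
      obtain ⟨c, rfl⟩ := hw
      have h1 := hni b
      have h2 := hni c
      rw [Fin.ext_iff] at hvw ⊢
      simp only [gFun] at hvw
      split_ifs at hvw <;> omega
    have hlt : (s y).sum (fun v => v.val) < m := by
      rw [hs, Finset.sum_image hinj, ← hm]
      refine Finset.sum_lt_sum (fun v _ => ?_) ⟨x b₀, ?_, ?_⟩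
      · simp only [gFun]
        split_ifs <;> omega
      · simp only [s, Finset.mem_filter, Finset.mem_univ, true_and]
        exact ⟨b₀, rfl⟩
      · simp only [gFun]
        split_ifs <;> omega
    obtain ⟨z, hz, hyz⟩ := ih _ hlt y rfl
    exact ⟨z, hz, Relation.ReflTransGen.head ⟨⟨i, hi⟩, Or.inl hy⟩ hyz⟩

/-- Below `⊤`, a packed map takes no value without taking all smaller ones. Since `y` induces the
same strict order, it must climb at least as fast. -/
theorem IsPacked.le_of_top_iff {x y : HeytingHom B (Fin n)} (hx : IsPacked x)
    (h : ∀ b, x b = ⊤ ↔ y b = ⊤) (b : B) : x b ≤ y b := by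
  by_cases hb : x b = ⊤
  · rw [(h b).1 hb]
    exact le_top
  rw [Fin.ext_iff, chain_top_val] at hb
  rw [Fin.le_def]
  induction hv : (x b).val generalizing b with
  | zero => exact Nat.zero_le _
  | succ v ih =>
    have hlt := (x b).isLt
    -- As `x b` is not top, `v ≤ n - 3`, so packedness covers every `v ≥ 1`; `⊥` covers `v = 0`.
    have : ∃ c, (x c).val = v := by
      rcases Nat.eq_zero_or_pos v with rfl | hpos
      · exact ⟨⊥, by rw [map_bot, chain_bot_val]⟩
      · exact hx v ⟨hpos, by omega⟩ ⟨b, hv⟩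
    obtain ⟨c, hc⟩ := this
    have h1 : (y c).val < (y b).val := by
      rw [← Fin.lt_def, ← lt_iff_lt_of_top_iff h, Fin.lt_def]
      omega
    have h2 := ih c (by omega) hc
    omega

/-- Homomorphisms with the same kernel filter are equivalent. -/
theorem equivalent_of_top_iff {x y : HeytingHom B (Fin n)} (h : ∀ b, x b = ⊤ ↔ y b = ⊤) :
    ((sigma n).dual B).Equivalent x y := by
  obtain ⟨x', hx', hxx'⟩ := exists_isPacked_equivalent x
  obtain ⟨y', hy', hyy'⟩ := exists_isPacked_equivalent y
  have h' (b : B) : x' b = ⊤ ↔ y' b = ⊤ :=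
    ((Equivalent.top_iff hxx' b).symm.trans (h b)).trans (Equivalent.top_iff hyy' b)
  obtain rfl : x' = y' := DFunLike.ext _ _ fun b =>
    le_antisymm (hx'.le_of_top_iff h' b) (hy'.le_of_top_iff (fun b => (h' b).symm) b)
  exact Relation.ReflTransGen.trans hxx' (Equivalent.symm hyy')

end Equivalent

/-! ### Amalgamation -/

section Amalgamation

variable {n : ℕ} [NeZero n] {A B C : Type u} [HeytingAlgebra A] [HeytingAlgebra B]
  [HeytingAlgebra C]

theorem AdmitsAmalgamation.symm {fB : HeytingHom A B} {fC : HeytingHom A C}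
    (h : AdmitsAmalgamation n fB fC) : AdmitsAmalgamation n fC fB := by
  obtain ⟨D, i, hD, hB, hC, hBi, hCi, hcomm⟩ := h
  exact ⟨D, i, hD, hC, hB, hCi, hBi, hcomm.symm⟩

/-- Only the kernel filter of `x` extends to the amalgam, not `x` itself; hence `y` is merely
equivalent to `x`. -/
theorem AdmitsAmalgamation.exists_equivalent (hn : 2 ≤ n) {fB : HeytingHom A B}
    {fC : HeytingHom A C} (h : AdmitsAmalgamation n fB fC) (x : (sigma n).dual B) :
    ∃ (y : (sigma n).dual B) (z : (sigma n).dual C), ((sigma n).dual B).Equivalent x y ∧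
      (sigma n).dualMap fB y = (sigma n).dualMap fC z := by
  obtain ⟨D, _, hD, hB, hC, hBi, -, hcomm⟩ := h
  obtain ⟨w, hw⟩ := hD.exists_extension hn hB hBi x
  refine ⟨w.comp hB, w.comp hC, equivalent_of_top_iff hw, ?_⟩
  change (w.comp hB).comp fB = (w.comp hC).comp fC
  rw [HeytingHom.comp_assoc, HeytingHom.comp_assoc, hcomm]

/-- The homomorphism into a power of the chain with the given coordinates. -/
def homPi {J : Type*} (p : J → HeytingHom B (Fin n)) : HeytingHom B (J → Fin n) where
  toFun := fun b j => p j b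
  map_sup' := fun a b => funext fun j => map_sup (p j) a b
  map_inf' := fun a b => funext fun j => map_inf (p j) a b
  map_bot' := funext fun j => map_bot (p j)
  map_himp' := fun a b => funext fun j => map_himp (p j) a b

theorem homPi_injective (hB : InG n B) {J : Type*} (p : J → HeytingHom B (Fin n))
    (h : ∀ x : (sigma n).dual B, ∃ j, ((sigma n).dual B).Equivalent x (p j)) :
    Function.Injective (homPi p) := by
  have key {a b : B} (hab : homPi p a = homPi p b) : a ≤ b := by
    by_contra hle
    obtain ⟨x, hxa, hxb⟩ := hB.exists_top_ne_top hle
    obtain ⟨j, hj⟩ := h x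
    refine hxb ((Equivalent.top_iff hj b).2 ?_)
    rw [← (Equivalent.top_iff hj a).1 hxa]
    exact (congrFun hab j).symm
  exact fun a b hab => le_antisymm (key hab) (key hab.symm)

end Amalgamation

end Goedel

theorem theorem6p4 (n : ℕ) [NeZero n] (hn : 4 ≤ n) {A B C : Type u}
    [HeytingAlgebra A] [HeytingAlgebra B] [HeytingAlgebra C]
    (hA : Goedel.InG n A) (hB : Goedel.InG n B) (hC : Goedel.InG n C)
    (fB : HeytingHom A B) (fC : HeytingHom A C)
    (hfB : Function.Injective fB) (hfC : Function.Injective fC) :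
    Goedel.AdmitsAmalgamation n fB fC ↔
      ((∀ x : (Goedel.sigma n).dual B,
          ∃ (y : (Goedel.sigma n).dual B) (z : (Goedel.sigma n).dual C),
            ((Goedel.sigma n).dual B).Equivalent x y ∧
              (Goedel.sigma n).dualMap fB y = (Goedel.sigma n).dualMap fC z) ∧
        (∀ x' : (Goedel.sigma n).dual C,
          ∃ (y' : (Goedel.sigma n).dual C) (z' : (Goedel.sigma n).dual B),
            ((Goedel.sigma n).dual C).Equivalent x' y' ∧
              (Goedel.sigma n).dualMap fC y' = (Goedel.sigma n).dualMap fB z')) := by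
  constructor
  · exact fun h => ⟨h.exists_equivalent (by omega), h.symm.exists_equivalent (by omega)⟩
  · rintro ⟨hb, hc⟩
    -- All pairs agreeing on `A`: (a) and (b) say that both projections meet every `≃`-class.
    let J : Type u :=
      { p : HeytingHom B (Fin n) × HeytingHom C (Fin n) // p.1.comp fB = p.2.comp fC }
    refine ⟨J → Fin n, inferInstance, ⟨J, HeytingHom.id _, Function.injective_id⟩,
      Goedel.homPi fun j : J => j.1.1, Goedel.homPi fun j : J => j.1.2,
      Goedel.homPi_injective hB _ fun x => ?_, Goedel.homPi_injective hC _ fun x => ?_, ?_⟩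
    · obtain ⟨y, z, hxy, hyz⟩ := hb x
      exact ⟨⟨(y, z), hyz⟩, hxy⟩
    · obtain ⟨y, z, hxy, hyz⟩ := hc x
      exact ⟨⟨(z, y), hyz.symm⟩, hxy⟩
    · exact DFunLike.ext _ _ fun a => funext fun j => DFunLike.congr_fun j.2 a
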